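/- A RetNet with model dimension $d$ is given by $\gamma\in\mathbb{R}$ and $W_A,W_C,W_V\in\mathbb{R}^{d\times d}$ (that is, $3d^2+1=O(d^2)$ parameters). On an input $u\in\mathbb{R}^{N\times d}$ it sets $A=uW_A$, $C=uW_C$, $V=uW_V$, runs the recurrence $$z^0=A[0,:]^\top V[0,:],\qquad z^n=\gamma z^{n-1}+A[n,:]^\top V[n,:]\quad(1\le n<N),$$ over $N$ steps, and outputs $\mathrm{Out}[n,:]=C[n,:]\,z^n$ for $0\le n<N$. A BaseConv layer of inner dimension $N'\times d'$ is a map $$y\mapsto (yW+b_1)\odot(y*h+b_2),\qquad W\in\mathbb{R}^{d'\times d'},\quad h,b_1,b_2\in\mathbb{R}^{N'\times d'},$$ where $\odot$ is the entrywise product and $*$ is the column-wise convolution, either linear (truncated to length $N'$) or cyclic. Its parameters are all the entries of $W,h,b_1,b_2$. A BaseConv model for $N\times d$ inputs consists of sizes $N'\ge N$, $d'\ge d$ and a finite sequence of such layers: the input is placed in the upper left corner of an $N'\times d'$ zero matrix, the layers are applied one after another, and the upper left $N\times d$ corner of the result is the output. The number of parameters of the model is the total over its distinct layers, i.e. layers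 with identical weights are counted once (as are the weights of the RetNet, which are shared by its $N$ steps). A butterfly matrix of size $n=2^k$ is a product $F_kF_{k-1}\cdots F_1$, where $F_j$ is block diagonal with blocks of size $2^j$, each of them a $2\times2$ block matrix of diagonal matrices of size $2^{j-1}$. Let $\mathcal{B}$ be the class of butterfly matrices and $\mathcal{BB}^*=\{M_1M_2^\top : M_1,M_2\in\mathcal{B}\text{ of equal size}\}$. The class $(\mathcal{BB}^*)^w_e$ consists of the upper left $m\times m$ corners of the $em\times em$ products of $w$ matrices from $\mathcal{BB}^*$. **Statement.** There are absolute constants $\kappa\in\mathbb{N}$ and $c>0$ such that, for every $N$, every $d\ge2$ and every RetNet with model dimension $d$, there is a BaseConv model whose output equals that of the RetNet on every input $u\in\mathbb{R}^{N\times d}$, such that 1. every weight matrix $W$ of the model is a K-matrix, i.e. lies in $(\mathcal{BB}^*)^w_e$ for some $w,e\le\kappa(\lfloor\log_2 d'\rfloor+1)^\kappa$; 2. the model has at most $c\,N\log d$ layers; 3. the model has at most $c\,(Nd+d^2)$ parameters, and at most $c\,Nd$ parameters if $d\le N$. In short: a RetNet with $O(d^2)$ parameters run over $N$ steps has an equivalent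 BaseConv model with $O(N\log d)$ layers and, when $d\le N$, $O(Nd)$ parameters. -/

import Mathlib

noncomputable section

namespace BaseConvSim

open Matrix

/-! ### Butterfly matrices and the kaleidoscope hierarchy -/

/-- A butterfly factor matrix of size `n` with block size `b`: block diagonal with blocks of size
`b`, every block being a `2 × 2` block matrix of diagonal `b/2 × b/2` matrices. Equivalently, an
entry `(i, j)` may be nonzero only if `i` and `j` lie in the same block of size `b` and have the
same offset modulo `b / 2`. -/
def IsButterflyFactor (n b : ℕ) (M : Matrix (Fin n) (Fin n) ℝ) : Prop :=
  ∀ i j : Fin n, M i j ≠ 0 →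
    (i : ℕ) / b = (j : ℕ) / b ∧ (i : ℕ) % (b / 2) = (j : ℕ) % (b / 2)

/-- Products `F_k * F_{k-1} * ⋯ * F_1`, where `F_j` is a butterfly factor matrix of size `n` with
block size `2 ^ j`. -/
def IsButterflyProduct (n : ℕ) : ℕ → Matrix (Fin n) (Fin n) ℝ → Prop
  | 0, M => M = 1
  | k + 1, M => ∃ F P : Matrix (Fin n) (Fin n) ℝ,
      IsButterflyFactor n (2 ^ (k + 1)) F ∧ IsButterflyProduct n k P ∧ M = F * P

/-- The class `B` of butterfly matrices; their size is a power of two. -/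
def IsButterfly (n : ℕ) (M : Matrix (Fin n) (Fin n) ℝ) : Prop :=
  ∃ k : ℕ, n = 2 ^ k ∧ IsButterflyProduct n k M

/-- The class `BB*`. -/
def IsBBStar (n : ℕ) (M : Matrix (Fin n) (Fin n) ℝ) : Prop :=
  ∃ M₁ M₂ : Matrix (Fin n) (Fin n) ℝ, IsButterfly n M₁ ∧ IsButterfly n M₂ ∧ M = M₁ * M₂ᵀ

/-- The class `(BB*)^w` of products of `w` matrices from `BB*`. -/
def IsBBStarPow (n : ℕ) : ℕ → Matrix (Fin n) (Fin n) ℝ → Prop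
  | 0, M => M = 1
  | w + 1, M => ∃ A P : Matrix (Fin n) (Fin n) ℝ, IsBBStar n A ∧ IsBBStarPow n w P ∧ M = A * P

/-- The class `(BB*)^w_e`: the upper left `m × m` corners of the `em × em` matrices
in `(BB*)^w`. -/
def IsKaleidoscope (m w e : ℕ) (M : Matrix (Fin m) (Fin m) ℝ) : Prop :=
  ∃ (h : m ≤ e * m) (E : Matrix (Fin (e * m)) (Fin (e * m)) ℝ),
    IsBBStarPow (e * m) w E ∧ ∀ i j : Fin m, M i j = E (Fin.castLE h i) (Fin.castLE h j)

/-- K-matrices: members of `(BB*)^w_e` whose width `w` and expansion `e` are at most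
polylogarithmic in the size `m`, with the polylogarithm `κ * (log₂ m + 1) ^ κ`. -/
def IsKMatrix (κ m : ℕ) (M : Matrix (Fin m) (Fin m) ℝ) : Prop :=
  ∃ w e : ℕ, w ≤ κ * (Nat.log 2 m + 1) ^ κ ∧ e ≤ κ * (Nat.log 2 m + 1) ^ κ ∧
    IsKaleidoscope m w e M

/-! ### RetNet -/

/-- The parameters of a RetNet: a scalar and three `d × d` weight matrices. -/
structure RetNet (d : ℕ) where
  γ : ℝ
  WA : Matrix (Fin d) (Fin d) ℝ
  WC : Matrix (Fin d) (Fin d) ℝ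
  WV : Matrix (Fin d) (Fin d) ℝ

/-- The states `z^0 = A[0,:]ᵀ V[0,:]` and `z^n = γ z^{n-1} + A[n,:]ᵀ V[n,:]`, where `A = u W_A`
and `V = u W_V`. -/
def RetNet.state {N d : ℕ} (R : RetNet d) (u : Matrix (Fin N) (Fin d) ℝ) :
    (n : ℕ) → n < N → Matrix (Fin d) (Fin d) ℝ
  | 0, h => vecMulVec ((u * R.WA) ⟨0, h⟩) ((u * R.WV) ⟨0, h⟩)
  | n + 1, h => R.γ • R.state u n (Nat.lt_of_succ_lt h) +
      vecMulVec ((u * R.WA) ⟨n + 1, h⟩) ((u * R.WV) ⟨n + 1, h⟩)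

/-- The output `Out[n,:] = C[n,:] z^n`, where `C = u W_C`. -/
def RetNet.output {N d : ℕ} (R : RetNet d) (u : Matrix (Fin N) (Fin d) ℝ) :
    Matrix (Fin N) (Fin d) ℝ :=
  Matrix.of fun n => (u * R.WC) n ᵥ* R.state u n n.isLt

/-! ### BaseConv -/

/-- Column-wise linear convolution, truncated modulo `X ^ n`. -/
def causalConv {n m : ℕ} (u h : Matrix (Fin n) (Fin m) ℝ) : Matrix (Fin n) (Fin m) ℝ :=
  Matrix.of fun r t => ∑ i : Fin n, ∑ j : Fin n,
    if (i : ℕ) + (j : ℕ) = (r : ℕ) then u i t * h j t else 0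

/-- Column-wise cyclic convolution, modulo `X ^ n - 1`. -/
def cyclicConv {n m : ℕ} (u h : Matrix (Fin n) (Fin m) ℝ) : Matrix (Fin n) (Fin m) ℝ :=
  Matrix.of fun r t => ∑ i : Fin n, ∑ j : Fin n,
    if ((i : ℕ) + (j : ℕ)) % n = (r : ℕ) then u i t * h j t else 0

/-- A BaseConv layer of inner dimension `n × m`; the flag says whether its convolution is the
cyclic one or the linear one. -/
structure BaseConvLayer (n m : ℕ) where
  W : Matrix (Fin m) (Fin m) ℝ
  h : Matrix (Fin n) (Fin m) ℝ
  b₁ : Matrix (Fin n) (Fin m) ℝ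
  b₂ : Matrix (Fin n) (Fin m) ℝ
  cyclic : Bool

/-- `(u W + b₁) ⊙ (u ∗ h + b₂)`. -/
def BaseConvLayer.eval {n m : ℕ} (ℓ : BaseConvLayer n m) (u : Matrix (Fin n) (Fin m) ℝ) :
    Matrix (Fin n) (Fin m) ℝ :=
  (u * ℓ.W + ℓ.b₁) ⊙ ((if ℓ.cyclic then cyclicConv u ℓ.h else causalConv u ℓ.h) + ℓ.b₂)

/-- A BaseConv model for `N × d` inputs and outputs, with inner dimension `N' × d'`. The layers
are applied in the order of the list. -/
structure BaseConvModel (N d : ℕ) where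
  N' : ℕ
  d' : ℕ
  hN : N ≤ N'
  hd : d ≤ d'
  layers : List (BaseConvLayer N' d')

namespace BaseConvModel

variable {N d : ℕ} (M : BaseConvModel N d)

/-- The input is placed in the upper left corner and padded with zeros. -/
def embed (u : Matrix (Fin N) (Fin d) ℝ) : Matrix (Fin M.N') (Fin M.d') ℝ :=
  Matrix.of fun n t =>
    if h : (n : ℕ) < N ∧ (t : ℕ) < d then u ⟨n, h.1⟩ ⟨t, h.2⟩ else 0

/-- The output is the upper left corner of the output of the last layer. -/
def eval (u : Matrix (Fin N) (Fin d) ℝ) : Matrix (Fin N) (Fin d) ℝ :=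
  (M.layers.foldl (fun y ℓ => ℓ.eval y) (M.embed u)).submatrix (Fin.castLE M.hN) (Fin.castLE M.hd)

def numLayers : ℕ := M.layers.length

/-- The total number of parameters. A layer has the entries of `h`, `b₁`, `b₂` and `W` (zero or
not) as parameters. Layers that share all their parameters are counted once, as the weights of a
RetNet, which are shared by all time steps, are counted once. -/
def numParams : ℕ :=
  {ℓ | ℓ ∈ M.layers}.ncard * (3 * (M.N' * M.d') + M.d' ^ 2)

end BaseConvModel

end BaseConvSim

end

noncomputable section

namespace BaseConvSim

open Matrix

/-! ### Butterfly matrices -/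

/-! Since `vecMulVec (x W_A) (x W_V) = W_Aᵀ (xᵀ x) W_V`, the weights factor out of the recurrence:
`z^p = W_Aᵀ Z W_V` with `Z` the decayed Gram matrix of the input rows, so the output row is `x G Z
W_V` with `G = W_C W_Aᵀ` (`RetNet.output_eq`). One time step therefore consists of a rank-one update
of `Z` and three vector-matrix products.

The arbitrary matrices `G` and `W_V` need not be K-matrices, because they never occur in a weight
`W`. They enter through the bias `b₂`: broadcast the vector along rows or columns, multiply
entrywise by the matrix, then sum along the other direction. Column sums are cyclic convolutions
with the all-ones filter, and row sums are a weight matrix with an all-ones block, which is a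
product of butterfly factors (`isButterflyProduct_blockSum`).

The input lies on a cyclic tape that is rotated by one row per step, so that the current row is
always row 0. Hence all time steps use the same 22 layers (`stepLayers_eval`), and one further
rotation restores the alignment. The layer count is linear in `N`, while the number of distinct
layers is bounded, which gives the parameter bound. -/

theorem IsButterflyFactor.one (n b : ℕ) : IsButterflyFactor n b 1 := by
  intro i j h
  obtain rfl : i = j := by
    by_contra hij
    exact h (Matrix.one_apply_ne hij)
  exact ⟨rfl, rfl⟩

theorem IsButterflyProduct.succ {n k : ℕ} {M : Matrix (Fin n) (Fin n) ℝ}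
    (h : IsButterflyProduct n k M) : IsButterflyProduct n (k + 1) M :=
  ⟨1, M, .one _ _, h, (one_mul M).symm⟩

theorem IsButterflyProduct.mono {n k l : ℕ} {M : Matrix (Fin n) (Fin n) ℝ}
    (h : IsButterflyProduct n k M) (hkl : k ≤ l) : IsButterflyProduct n l M := by
  induction hkl with
  | refl => exact h
  | step _ ih => exact ih.succ

theorem IsButterflyProduct.one (n k : ℕ) : IsButterflyProduct n k 1 :=
  IsButterflyProduct.mono (k := 0) rfl (Nat.zero_le k)

theorem IsButterflyFactor.isButterflyProduct {n k : ℕ} {F : Matrix (Fin n) (Fin n) ℝ}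
    (h : IsButterflyFactor n (2 ^ (k + 1)) F) : IsButterflyProduct n (k + 1) F :=
  ⟨F, 1, h, .one n k, (mul_one F).symm⟩

theorem IsBBStarPow.isKaleidoscope {m w : ℕ} {M : Matrix (Fin m) (Fin m) ℝ}
    (h : IsBBStarPow m w M) : IsKaleidoscope m w 1 M := by
  -- The size `1 * m` is only propositionally equal to `m`, so it is generalised before
  -- substituting.
  have key : ∀ n (hn : n = m), ∃ (h : m ≤ n) (E : Matrix (Fin n) (Fin n) ℝ),
      IsBBStarPow n w E ∧ ∀ i j : Fin m, M i j = E (Fin.castLE h i) (Fin.castLE h j) := by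
    rintro n rfl
    exact ⟨le_rfl, M, h, fun i j => rfl⟩
  exact key _ (one_mul m)

/-- Missing factors are filled with identities and the second butterfly matrix is taken to be 1, so
width and expansion 1 suffice. -/
theorem IsButterflyProduct.isKMatrix {m k l : ℕ} {M : Matrix (Fin m) (Fin m) ℝ}
    (h : IsButterflyProduct m k M) (hm : m = 2 ^ l) (hk : k ≤ l) : IsKMatrix 1 m M := by
  have h1 : IsBBStarPow m 1 M :=
    ⟨M, 1, ⟨M, 1, ⟨l, hm, h.mono hk⟩, ⟨l, hm, .one _ _⟩, by simp⟩, rfl, (mul_one M).symm⟩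
  exact ⟨1, 1, by simp, by simp, h1.isKaleidoscope⟩

/-- The matrix that sums over the blocks of size `2 ^ j` inside the `q`-th block of size `2 ^ k`
and is the identity elsewhere. -/
def blockSum (n k q j : ℕ) : Matrix (Fin n) (Fin n) ℝ :=
  Matrix.of fun x y =>
    if (x : ℕ) / 2 ^ k = q then (if (x : ℕ) / 2 ^ j = (y : ℕ) / 2 ^ j then 1 else 0)
    else if x = y then 1 else 0

/-- Summation by repeated halving: a sum over a block of size `2 ^ (j + 1)` adds its two half-block
sums. The new factor `F` does this by joining positions with equal offset modulo `2 ^ j`. -/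
theorem isButterflyProduct_blockSum {n k q j : ℕ} (hj : j ≤ k) (hn : 2 ^ k ∣ n) :
    IsButterflyProduct n j (blockSum n k q j) := by
  induction j with
  | zero =>
    ext x y
    simp [blockSum, Matrix.one_apply, Fin.ext_iff]
  | succ j ih =>
    let F : Matrix (Fin n) (Fin n) ℝ := Matrix.of fun x y =>
      if (x : ℕ) / 2 ^ k = q then
        (if (x : ℕ) / 2 ^ (j + 1) = (y : ℕ) / 2 ^ (j + 1) ∧ (x : ℕ) % 2 ^ j = (y : ℕ) % 2 ^ j
          then 1 else 0)
      else if x = y then 1 else 0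
    have hblock : ∀ i l x y : ℕ, i ≤ l → x / 2 ^ i = y / 2 ^ i → x / 2 ^ l = y / 2 ^ l := by
      intro i l x y hil h
      obtain ⟨c, rfl⟩ := Nat.exists_eq_add_of_le hil
      rw [pow_add, ← Nat.div_div_eq_div_mul, ← Nat.div_div_eq_div_mul, h]
    refine ⟨F, blockSum n k q j, ?_, ih (by omega), ?_⟩
    · intro x y h
      have h2 : 2 ^ (j + 1) / 2 = 2 ^ j := by rw [pow_succ]; simp
      rw [h2]
      simp only [F, Matrix.of_apply] at h
      split_ifs at h with h1 h3 h4
      · exact h3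
      · exact absurd rfl h
      · subst h4; exact ⟨rfl, rfl⟩
      · exact absurd rfl h
    · ext x y
      rw [Matrix.mul_apply]
      by_cases hx : (x : ℕ) / 2 ^ k = q
      · have hpos : 0 < 2 ^ j := by positivity
        -- The only intermediate index that can contribute to entry `(x, y)`: the half-block of `y`
        -- with the offset of `x`.
        have hz : (y : ℕ) / 2 ^ j * 2 ^ j + (x : ℕ) % 2 ^ j < n := by
          obtain ⟨c, hc⟩ : 2 ^ j ∣ n := (pow_dvd_pow 2 (by omega)).trans hn
          have h1 : (y : ℕ) / 2 ^ j < c := by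
            rw [Nat.div_lt_iff_lt_mul hpos, mul_comm, ← hc]
            exact y.2
          have h2 := Nat.mod_lt (x : ℕ) hpos
          calc (y : ℕ) / 2 ^ j * 2 ^ j + (x : ℕ) % 2 ^ j
              < (y : ℕ) / 2 ^ j * 2 ^ j + 2 ^ j := by omega
            _ = ((y : ℕ) / 2 ^ j + 1) * 2 ^ j := by ring
            _ ≤ c * 2 ^ j := Nat.mul_le_mul_right _ h1
            _ = n := by rw [hc, mul_comm]
        have hzd : ((y : ℕ) / 2 ^ j * 2 ^ j + (x : ℕ) % 2 ^ j) / 2 ^ j = (y : ℕ) / 2 ^ j := by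
          rw [mul_comm, Nat.mul_add_div hpos, Nat.div_eq_of_lt (Nat.mod_lt _ hpos), add_zero]
        have hzm : ((y : ℕ) / 2 ^ j * 2 ^ j + (x : ℕ) % 2 ^ j) % 2 ^ j = (x : ℕ) % 2 ^ j := by
          rw [mul_comm, Nat.mul_add_mod, Nat.mod_mod]
        rw [Finset.sum_eq_single (⟨_, hz⟩ : Fin n)]
        · have hzd' := hblock j (j + 1) _ _ (by omega) hzd
          simp only [F, blockSum, Matrix.of_apply, if_pos hx, hzd', hzm, hzd, and_true]
          by_cases hxy : (x : ℕ) / 2 ^ (j + 1) = (y : ℕ) / 2 ^ (j + 1)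
          · have : ((y : ℕ) / 2 ^ j * 2 ^ j + (x : ℕ) % 2 ^ j) / 2 ^ k = q := by
              rw [hblock (j + 1) k _ _ hj (hzd'.trans hxy.symm), hx]
            simp [hxy, this]
          · simp [hxy]
        · intro z _ hne
          simp only [F, blockSum, Matrix.of_apply, if_pos hx]
          split_ifs with h1 h2 h3 h4 h5
          · exfalso
            apply hne
            ext
            simp only
            rw [← h3, h1.2, mul_comm, Nat.div_add_mod]
          · simp
          · exact absurd ((hblock (j + 1) k _ _ hj h1.1).symm.trans hx) h2
          · simp
          all_goals simp
        · simp
      · rw [Finset.sum_eq_single x (fun z _ hz => by simp [F, hx, hz.symm]) (by simp)]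
        simp [F, blockSum, hx]

/-! ### Layers acting on four column registers -/

section Registers

variable {n D : ℕ}

/-- Four registers of width `D`, written side by side. -/
def pack (Y : Fin 4 → Matrix (Fin n) (Fin D) ℝ) : Matrix (Fin n) (Fin (4 * D)) ℝ :=
  Matrix.of fun r c => Y c.divNat r c.modNat

/-- The square matrix whose `D × D` blocks are `P a b`. -/
def packSquare (P : Fin 4 → Fin 4 → Matrix (Fin D) (Fin D) ℝ) :
    Matrix (Fin (4 * D)) (Fin (4 * D)) ℝ :=
  Matrix.of fun x y => P x.divNat y.divNat x.modNat y.modNat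

theorem pack_mul_packSquare (Y : Fin 4 → Matrix (Fin n) (Fin D) ℝ)
    (P : Fin 4 → Fin 4 → Matrix (Fin D) (Fin D) ℝ) :
    pack Y * packSquare P = pack fun b => ∑ a, Y a * P a b := by
  ext r c
  rw [Matrix.mul_apply, ← finProdFinEquiv.sum_comp, Fintype.sum_prod_type]
  simp only [pack, packSquare, Matrix.of_apply, Matrix.sum_apply, Matrix.mul_apply]
  refine Finset.sum_congr rfl fun a _ => Finset.sum_congr rfl fun i _ => ?_
  have h := finProdFinEquiv.symm_apply_apply (a, i)
  rw [finProdFinEquiv_symm_apply, Prod.mk.injEq] at h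
  rw [h.1, h.2]

theorem cyclicConv_pack (Y h : Fin 4 → Matrix (Fin n) (Fin D) ℝ) :
    cyclicConv (pack Y) (pack h) = pack fun b => cyclicConv (Y b) (h b) := rfl

/-- The layer with cyclic convolution whose weights are given register by register. -/
def regLayer (P : Fin 4 → Fin 4 → Matrix (Fin D) (Fin D) ℝ)
    (h b₁ b₂ : Fin 4 → Matrix (Fin n) (Fin D) ℝ) : BaseConvLayer n (4 * D) :=
  ⟨packSquare P, pack h, pack b₁, pack b₂, true⟩

theorem regLayer_eval (P : Fin 4 → Fin 4 → Matrix (Fin D) (Fin D) ℝ)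
    (h b₁ b₂ Y : Fin 4 → Matrix (Fin n) (Fin D) ℝ) :
    (regLayer P h b₁ b₂).eval (pack Y) =
      pack fun b => ((∑ a, Y a * P a b) + b₁ b) ⊙ (cyclicConv (Y b) (h b) + b₂ b) := by
  simp only [BaseConvLayer.eval, regLayer, pack_mul_packSquare, if_true, cyclicConv_pack]
  rfl

/-- The matrix with all entries equal to one. -/
def allOnes (m n : ℕ) : Matrix (Fin m) (Fin n) ℝ := Matrix.of fun _ _ => 1

/-- The filter that shifts every column cyclically by `s`. -/
def impulse (n D s : ℕ) : Matrix (Fin n) (Fin D) ℝ :=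
  Matrix.of fun i _ => if (i : ℕ) = s then 1 else 0

/-! ### Cyclic convolution with impulses and with ones -/

theorem hadamard_allOnes (M : Matrix (Fin n) (Fin D) ℝ) : M ⊙ allOnes n D = M := by
  ext; simp [allOnes]

theorem allOnes_hadamard (M : Matrix (Fin n) (Fin D) ℝ) : allOnes n D ⊙ M = M := by
  ext; simp [allOnes]

theorem cyclicConv_zero (M : Matrix (Fin n) (Fin D) ℝ) : cyclicConv M 0 = 0 := by
  ext; simp [cyclicConv]

/-- Both sums are below `2 * n`, so each reduction subtracts `n` at most once. -/
theorem add_mod_eq_iff {n i s r : ℕ} (hi : i < n) (hr : r < n) (hs : s ≤ n) :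
    (i + s) % n = r ↔ i = (r + (n - s)) % n := by
  have key : ∀ a b, a < n → b ≤ n → (a + b) % n = if a + b < n then a + b else a + b - n := by
    intro a b ha hb
    split_ifs with h
    · exact Nat.mod_eq_of_lt h
    · rw [Nat.mod_eq_sub_mod (by omega), Nat.mod_eq_of_lt (by omega)]
  rw [key i s hi hs, key r (n - s) hr (by omega)]
  split_ifs <;> omega

theorem cyclicConv_impulse (M : Matrix (Fin n) (Fin D) ℝ) {s : ℕ} (hs : s < n) (r : Fin n)
    (t : Fin D) : cyclicConv M (impulse n D s) r t =
      M ⟨((r : ℕ) + (n - s)) % n, Nat.mod_lt _ (by omega)⟩ t := by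
  simp only [cyclicConv, impulse, Matrix.of_apply]
  rw [Finset.sum_eq_single ⟨((r : ℕ) + (n - s)) % n, Nat.mod_lt _ (by omega)⟩]
  · rw [Finset.sum_eq_single ⟨s, hs⟩]
    · rw [if_pos ((add_mod_eq_iff (Nat.mod_lt _ (by omega)) r.2 hs.le).2 rfl)]
      simp
    · intro j _ hj
      have hj' : (j : ℕ) ≠ s := fun h => hj (Fin.ext h)
      simp [hj']
    · simp
  · intro i _ hi
    refine Finset.sum_eq_zero fun j _ => ?_
    split_ifs with h1 h2
    · rw [h2, add_mod_eq_iff i.2 r.2 hs.le] at h1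
      exact absurd (Fin.ext h1) hi
    all_goals simp
  · simp

theorem cyclicConv_impulse_zero (M : Matrix (Fin n) (Fin D) ℝ) :
    cyclicConv M (impulse n D 0) = M := by
  ext r t
  rw [cyclicConv_impulse M r.pos]
  congr 1
  ext
  simp [Nat.mod_eq_of_lt r.2]

/-- For each `i` exactly one `j` satisfies `i + j ≡ r` modulo `n`, so every row receives each entry
of the column once. -/
theorem cyclicConv_allOnes (M : Matrix (Fin n) (Fin D) ℝ) (r : Fin n) (t : Fin D) :
    cyclicConv M (allOnes n D) r t = ∑ i, M i t := by
  simp only [cyclicConv, allOnes, Matrix.of_apply, mul_one]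
  refine Finset.sum_congr rfl fun i _ => ?_
  rw [Finset.sum_eq_single ⟨((r : ℕ) + (n - i)) % n, Nat.mod_lt _ i.pos⟩]
  · rw [if_pos]
    rw [add_comm, add_mod_eq_iff (Nat.mod_lt _ i.pos) r.2 i.2.le]
  · intro j _ hj
    rw [if_neg]
    rw [add_comm, add_mod_eq_iff j.2 r.2 i.2.le]
    exact fun h => hj (Fin.ext h)
  · simp

/-- Add `β` times register `a` to `α` times register `b`, as a matrix on registers. -/
def linCoeff (a b : Fin 4) (α β : ℝ) : Fin 4 → Fin 4 → Matrix (Fin D) (Fin D) ℝ :=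
  fun x y => if y = b then (if x = b then α else if x = a then β else 0) • 1
    else if x = y then 1 else 0

/-- Replace register `b` by `α` times itself plus `β` times register `a`. -/
def linLayer (n D : ℕ) (a b : Fin 4) (α β : ℝ) : BaseConvLayer n (4 * D) :=
  regLayer (linCoeff a b α β) 0 0 fun _ => allOnes n D

/-- Multiply register `b` entrywise by register `a`. -/
def mulLayer (n D : ℕ) (a b : Fin 4) : BaseConvLayer n (4 * D) :=
  regLayer (linCoeff a b 0 1) (Function.update 0 b (impulse n D 0)) 0
    (Function.update (fun _ => allOnes n D) b 0)

/-- Multiply register `b` entrywise by a fixed matrix. -/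
def maskLayer (b : Fin 4) (B : Matrix (Fin n) (Fin D) ℝ) : BaseConvLayer n (4 * D) :=
  regLayer (linCoeff b b 1 0) 0 0 (Function.update (fun _ => allOnes n D) b B)

/-- Convolve the columns of register `b` with those of a fixed matrix. -/
def convLayer (b : Fin 4) (k : Matrix (Fin n) (Fin D) ℝ) : BaseConvLayer n (4 * D) :=
  regLayer 0 (Function.update (fun _ => impulse n D 0) b k) (fun _ => allOnes n D) 0

/-- Replace every entry of the last register by the sum of its row. -/
def sumLayer (n D : ℕ) : BaseConvLayer n (4 * D) :=
  regLayer (fun a b => if a = b then (if a = 3 then allOnes D D else 1) else 0) 0 0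
    fun _ => allOnes n D

/-! ### Effect of the elementary layers on the registers -/

theorem sum_mul_linCoeff (a b : Fin 4) (hab : a ≠ b) (α β : ℝ)
    (Y : Fin 4 → Matrix (Fin n) (Fin D) ℝ) (c : Fin 4) :
    ∑ x, Y x * linCoeff (D := D) a b α β x c = Function.update Y b (α • Y b + β • Y a) c := by
  by_cases h : c = b
  · subst h
    rw [← Finset.add_sum_erase _ _ (Finset.mem_univ c),
      ← Finset.add_sum_erase _ _ (Finset.mem_erase.2 ⟨hab, Finset.mem_univ a⟩),
      Finset.sum_eq_zero, Function.update_self]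
    · simp [linCoeff, hab]
    · intro x hx
      simp only [Finset.mem_erase] at hx
      simp [linCoeff, hx.1, hx.2.1]
  · rw [Function.update_of_ne h, Finset.sum_eq_single c]
    · simp [linCoeff, h]
    · intro x _ hx
      simp [linCoeff, h, hx]
    · simp

theorem sum_mul_ite (Y : Fin 4 → Matrix (Fin n) (Fin D) ℝ)
    (Q : Fin 4 → Matrix (Fin D) (Fin D) ℝ) (c : Fin 4) :
    (∑ a, Y a * if a = c then Q a else 0) = Y c * Q c := by
  rw [Finset.sum_eq_single c]
  · simp
  · intro x _ hx
    simp [hx]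
  · simp

theorem linCoeff_self (b : Fin 4) :
    (linCoeff b b 1 0 : Fin 4 → Fin 4 → Matrix (Fin D) (Fin D) ℝ) =
      fun x y => if x = y then 1 else 0 := by
  funext x y
  by_cases h : y = b
  · subst h
    by_cases hx : x = y <;> simp [linCoeff, hx]
  · simp [linCoeff, h]

theorem linLayer_eval {a b : Fin 4} (hab : a ≠ b) (α β : ℝ)
    (Y : Fin 4 → Matrix (Fin n) (Fin D) ℝ) :
    (linLayer n D a b α β).eval (pack Y) =
      pack (Function.update Y b (α • Y b + β • Y a)) := by
  rw [linLayer, regLayer_eval]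
  congr 1
  funext c
  rw [sum_mul_linCoeff a b hab]
  simp [cyclicConv_zero, hadamard_allOnes]

theorem mulLayer_eval {a b : Fin 4} (hab : a ≠ b) (Y : Fin 4 → Matrix (Fin n) (Fin D) ℝ) :
    (mulLayer n D a b).eval (pack Y) = pack (Function.update Y b (Y a ⊙ Y b)) := by
  rw [mulLayer, regLayer_eval]
  congr 1
  funext c
  rw [sum_mul_linCoeff a b hab]
  by_cases h : c = b
  · subst h
    simp [cyclicConv_impulse_zero]
  · simp [h, cyclicConv_zero, hadamard_allOnes]

theorem maskLayer_eval (b : Fin 4) (B : Matrix (Fin n) (Fin D) ℝ)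
    (Y : Fin 4 → Matrix (Fin n) (Fin D) ℝ) :
    (maskLayer b B).eval (pack Y) = pack (Function.update Y b (Y b ⊙ B)) := by
  rw [maskLayer, regLayer_eval, linCoeff_self]
  congr 1
  funext c
  rw [sum_mul_ite Y fun _ => 1]
  by_cases h : c = b
  · subst h
    simp [cyclicConv_zero]
  · simp [h, cyclicConv_zero, hadamard_allOnes]

theorem convLayer_eval (b : Fin 4) (k : Matrix (Fin n) (Fin D) ℝ)
    (Y : Fin 4 → Matrix (Fin n) (Fin D) ℝ) :
    (convLayer b k).eval (pack Y) = pack (Function.update Y b (cyclicConv (Y b) k)) := by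
  rw [convLayer, regLayer_eval]
  congr 1
  funext c
  by_cases h : c = b
  · subst h
    simp [allOnes_hadamard]
  · simp [h, cyclicConv_impulse_zero, allOnes_hadamard]

theorem sumLayer_eval (Y : Fin 4 → Matrix (Fin n) (Fin D) ℝ) :
    (sumLayer n D).eval (pack Y) = pack (Function.update Y 3 (Y 3 * allOnes D D)) := by
  rw [sumLayer, regLayer_eval]
  congr 1
  funext c
  rw [sum_mul_ite Y fun a => if a = 3 then allOnes D D else 1]
  by_cases h : c = 3
  · subst h
    simp [cyclicConv_zero, hadamard_allOnes]
  · simp [h, cyclicConv_zero, hadamard_allOnes]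

/-! ### The weight matrices are K-matrices -/

/-- A register index has two bits, and the hypothesis says that `a` and `b` differ in at most one of
them. The matrix is then a single butterfly factor, of block size `2 ^ (k + 1)` for the low bit and
`2 ^ (k + 2)` for the high bit. -/
theorem isKMatrix_linCoeff {k : ℕ} {a b : Fin 4} (α β : ℝ)
    (hab : (a : ℕ) / 2 = b / 2 ∨ (a : ℕ) % 2 = b % 2) :
    IsKMatrix 1 (4 * 2 ^ k) (packSquare (linCoeff (D := 2 ^ k) a b α β)) := by
  have hsize : 4 * 2 ^ k = 2 ^ (k + 2) := by ring
  have hsupp : ∀ x y : Fin (4 * 2 ^ k), packSquare (linCoeff (D := 2 ^ k) a b α β) x y ≠ 0 →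
      (x : ℕ) % 2 ^ k = y % 2 ^ k ∧ (x.divNat = y.divNat ∨ x.divNat = a ∧ y.divNat = b) := by
    intro x y h
    simp only [packSquare, linCoeff, Matrix.of_apply] at h
    have hone : (1 : Matrix (Fin (2 ^ k)) (Fin (2 ^ k)) ℝ) x.modNat y.modNat ≠ 0 →
        (x : ℕ) % 2 ^ k = y % 2 ^ k := by
      intro h1
      by_contra hne
      exact h1 (Matrix.one_apply_ne fun h2 => hne (congrArg Fin.val h2))
    split_ifs at h with h1 h2 h3 h4 <;> try simp only [Matrix.smul_apply, smul_eq_mul] at h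
    · exact ⟨hone (right_ne_zero_of_mul h), Or.inl (h2.trans h1.symm)⟩
    · exact ⟨hone (right_ne_zero_of_mul h), Or.inr ⟨h3, h1⟩⟩
    · simp at h
    · exact ⟨hone h, Or.inl h4⟩
    · simp at h
  rcases hab with hab | hab
  · refine (IsButterflyFactor.isButterflyProduct (k := k) ?_).isKMatrix hsize (by omega)
    intro x y h
    obtain ⟨h1, h2⟩ := hsupp x y h
    rw [pow_succ, Nat.mul_div_cancel _ two_pos, ← Nat.div_div_eq_div_mul,
      ← Nat.div_div_eq_div_mul]
    refine ⟨?_, h1⟩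
    rcases h2 with h2 | ⟨h2, h3⟩
    · exact congrArg (· / 2) (congrArg Fin.val h2)
    · rw [← h2, ← h3] at hab
      exact hab
  · refine (IsButterflyFactor.isButterflyProduct (k := k + 1) ?_).isKMatrix hsize (by omega)
    intro x y h
    obtain ⟨h1, h2⟩ := hsupp x y h
    rw [pow_succ 2 (k + 1), Nat.mul_div_cancel _ two_pos]
    constructor
    · rw [Nat.div_eq_of_lt, Nat.div_eq_of_lt]
      · have := y.2; omega
      · have := x.2; omega
    · rw [pow_succ, Nat.mod_mul, Nat.mod_mul, h1]
      congr 2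
      rcases h2 with h2 | ⟨h2, h3⟩
      · exact congrArg (· % 2) (congrArg Fin.val h2)
      · rw [← h2, ← h3] at hab
        exact hab

theorem isKMatrix_linLayer {k : ℕ} {a b : Fin 4} (α β : ℝ)
    (hab : (a : ℕ) / 2 = b / 2 ∨ (a : ℕ) % 2 = b % 2) :
    IsKMatrix 1 (4 * 2 ^ k) (linLayer n (2 ^ k) a b α β).W :=
  isKMatrix_linCoeff α β hab

theorem isKMatrix_mulLayer {k : ℕ} {a b : Fin 4}
    (hab : (a : ℕ) / 2 = b / 2 ∨ (a : ℕ) % 2 = b % 2) :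
    IsKMatrix 1 (4 * 2 ^ k) (mulLayer n (2 ^ k) a b).W :=
  isKMatrix_linCoeff 0 1 hab

theorem isKMatrix_maskLayer {k : ℕ} (b : Fin 4) (B : Matrix (Fin n) (Fin (2 ^ k)) ℝ) :
    IsKMatrix 1 (4 * 2 ^ k) (maskLayer b B).W :=
  isKMatrix_linCoeff 1 0 (Or.inl rfl)

theorem isKMatrix_convLayer {k : ℕ} (b : Fin 4) (h : Matrix (Fin n) (Fin (2 ^ k)) ℝ) :
    IsKMatrix 1 (4 * 2 ^ k) (convLayer b h).W := by
  have hsize : 4 * 2 ^ k = 2 ^ (k + 2) := by ring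
  refine (IsButterflyFactor.isButterflyProduct (k := 0) ?_).isKMatrix hsize (by omega)
  intro x y hxy
  exact absurd rfl hxy

theorem isKMatrix_sumLayer (k : ℕ) : IsKMatrix 1 (4 * 2 ^ k) (sumLayer n (2 ^ k)).W := by
  have hsize : 4 * 2 ^ k = 2 ^ (k + 2) := by ring
  have h := isButterflyProduct_blockSum (n := 4 * 2 ^ k) (q := 3) (le_refl k)
    (Dvd.intro_left 4 rfl)
  refine IsButterflyProduct.isKMatrix (k := k) ?_ hsize (by omega)
  convert h using 1
  ext x y
  have hx3 : x.divNat = 3 ↔ (x : ℕ) / 2 ^ k = 3 := Fin.ext_iff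
  have hdiv : x.divNat = y.divNat ↔ (x : ℕ) / 2 ^ k = y / 2 ^ k := Fin.ext_iff
  have hmod : x.modNat = y.modNat ↔ (x : ℕ) % 2 ^ k = y % 2 ^ k := Fin.ext_iff
  have hxy : x = y ↔ (x : ℕ) / 2 ^ k = y / 2 ^ k ∧ (x : ℕ) % 2 ^ k = y % 2 ^ k := by
    rw [Fin.ext_iff]
    refine ⟨fun h => by simp [h], fun h => ?_⟩
    rw [← Nat.div_add_mod (x : ℕ) (2 ^ k), h.1, h.2, Nat.div_add_mod]
  simp only [sumLayer, regLayer, packSquare, blockSum, Matrix.of_apply, hx3, hdiv, hxy]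
  by_cases h1 : (x : ℕ) / 2 ^ k = 3
  · by_cases h2 : (x : ℕ) / 2 ^ k = y / 2 ^ k
    · rw [if_pos h2, if_pos h1, if_pos h1, if_pos h2]; rfl
    · rw [if_neg h2, if_pos h1, if_neg h2]; rfl
  · by_cases h2 : (x : ℕ) / 2 ^ k = y / 2 ^ k
    · rw [if_pos h2, if_neg h1, if_neg h1, Matrix.one_apply]
      simp [hmod, h2]
    · rw [if_neg h2, if_neg h1, if_neg (fun h => h2 h.1)]; rfl

end Registers

/-! ### Zero padding -/

section Padding

variable {a b n m : ℕ}

/-- Extend a matrix by zeros, or cut it off, to size `n × m`. -/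
def pad (n m : ℕ) (M : Matrix (Fin a) (Fin b) ℝ) : Matrix (Fin n) (Fin m) ℝ :=
  Matrix.of fun i j => if h : (i : ℕ) < a ∧ (j : ℕ) < b then M ⟨i, h.1⟩ ⟨j, h.2⟩ else 0

/-- Extend a vector by zeros. -/
def padVec (x : Fin a → ℝ) (i : ℕ) : ℝ := if h : i < a then x ⟨i, h⟩ else 0

/-- All rows are the vector `x`, padded by zeros. -/
def rowCast (n m : ℕ) (x : Fin a → ℝ) : Matrix (Fin n) (Fin m) ℝ :=
  Matrix.of fun _ j => padVec x j

/-- All columns are the vector `x`, padded by zeros. -/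
def colCast (n m : ℕ) (x : Fin a → ℝ) : Matrix (Fin n) (Fin m) ℝ :=
  Matrix.of fun i _ => padVec x i

theorem sum_padVec_mul (h : a ≤ n) (x : Fin a → ℝ) (f : Fin n → ℝ) :
    ∑ i : Fin n, padVec x i * f i = ∑ i : Fin a, x i * f (Fin.castLE h i) := by
  obtain ⟨c, rfl⟩ := Nat.exists_eq_add_of_le h
  rw [Fin.sum_univ_add]
  have h0 : ∀ i : Fin c, padVec x (Fin.natAdd a i : ℕ) = 0 := fun i => by simp [padVec]
  have h1 : ∀ i : Fin a, padVec x (Fin.castAdd c i : ℕ) = x i := fun i => by simp [padVec]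
  simp only [h0, h1, zero_mul, Finset.sum_const_zero, add_zero]
  rfl

theorem pad_castLE_right (h : b ≤ m) (M : Matrix (Fin a) (Fin b) ℝ) (i : Fin n) (j : Fin b) :
    pad n m M i (Fin.castLE h j) = padVec (fun i => M i j) i := by
  simp [pad, padVec]

theorem pad_castLE_left (h : a ≤ n) (M : Matrix (Fin a) (Fin b) ℝ) (i : Fin a) (j : Fin m) :
    pad n m M (Fin.castLE h i) j = padVec (M i) j := by
  simp [pad, padVec]

theorem padVec_sum {ι : Type*} (s : Finset ι) (f : ι → Fin a → ℝ) (i : ℕ) :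
    padVec (fun j => ∑ k ∈ s, f k j) i = ∑ k ∈ s, padVec (f k) i := by
  unfold padVec
  split_ifs <;> simp

theorem padVec_const_mul (c : ℝ) (x : Fin a → ℝ) (i : ℕ) :
    padVec (fun j => c * x j) i = c * padVec x i := by
  unfold padVec
  split_ifs <;> simp

/-- Matrix-vector product without `M` as a weight: scale the columns of `M` by `x`, then sum each
row. With `M = 1` it turns a row broadcast into a column broadcast. -/
theorem rowCast_hadamard_pad_mul (h : b ≤ m) (x : Fin b → ℝ) (M : Matrix (Fin a) (Fin b) ℝ) :
    (rowCast n m x ⊙ pad n m M) * allOnes m m = colCast n m (M *ᵥ x) := by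
  ext i j
  simp only [Matrix.mul_apply, hadamard_apply, rowCast, colCast, allOnes, Matrix.of_apply, mul_one]
  rw [sum_padVec_mul h x fun j => pad n m M i j]
  simp only [pad_castLE_right]
  have : M *ᵥ x = fun i => ∑ j, x j * M i j := by
    funext i
    simp only [Matrix.mulVec, dotProduct, mul_comm]
  rw [this, padVec_sum]
  simp only [padVec_const_mul]

/-- The dual product: scale rows, then sum columns. Row and column broadcasts alternate, so
successive products can be chained. -/
theorem cyclicConv_colCast_hadamard_pad (h : a ≤ n) (y : Fin a → ℝ)
    (M : Matrix (Fin a) (Fin b) ℝ) :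
    cyclicConv (colCast n m y ⊙ pad n m M) (allOnes n m) = rowCast n m (y ᵥ* M) := by
  ext i j
  rw [cyclicConv_allOnes]
  simp only [hadamard_apply, rowCast, colCast, Matrix.of_apply]
  rw [sum_padVec_mul h y fun i => pad n m M i j]
  simp only [pad_castLE_left]
  have : y ᵥ* M = fun j => ∑ i, y i * M i j := rfl
  rw [this, padVec_sum]
  simp only [padVec_const_mul]

theorem rowCast_hadamard_colCast (x : Fin a → ℝ) (y : Fin b → ℝ) :
    rowCast n m y ⊙ colCast n m x = pad n m (vecMulVec x y) := by
  ext i j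
  simp only [hadamard_apply, rowCast, colCast, pad, padVec, vecMulVec, Matrix.of_apply]
  split_ifs <;> first | (exfalso; tauto) | simp [mul_comm]

theorem pad_smul_add (c : ℝ) (M M' : Matrix (Fin a) (Fin b) ℝ) :
    c • pad n m M + pad n m M' = pad n m (c • M + M') := by
  ext i j
  simp only [pad, Matrix.add_apply, Matrix.smul_apply, Matrix.of_apply]
  split_ifs <;> simp

/-- Reads the tape head: only row 0 survives the mask, and the column sums copy it to all rows. -/
theorem cyclicConv_hadamard_impulse (hn : 0 < n) (T : Matrix (Fin n) (Fin m) ℝ)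
    {x : Fin a → ℝ} (hx : ∀ j : Fin m, T ⟨0, hn⟩ j = padVec x j) :
    cyclicConv (T ⊙ impulse n m 0) (allOnes n m) = rowCast n m x := by
  ext i j
  rw [cyclicConv_allOnes, Finset.sum_eq_single ⟨0, hn⟩]
  · simp [impulse, rowCast, hx]
  · intro k _ hk
    have : (k : ℕ) ≠ 0 := fun h => hk (Fin.ext h)
    simp [impulse, this]
  · simp

end Padding

/-! ### One time step -/

section Step

variable {n D d : ℕ}

/-- Layers for one time step. The registers hold the tape, two temporary matrices (the second and
the last register), and the state `∑ γ ^ (n - m) • xₘᵀ xₘ` (the third one). -/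
def stepLayers (n D : ℕ) (γ : ℝ) (G V : Matrix (Fin d) (Fin d) ℝ) :
    List (BaseConvLayer n (4 * D)) :=
  [linLayer n D 0 1 0 1, maskLayer 1 (impulse n D 0), convLayer 1 (allOnes n D),
    linLayer n D 1 3 0 1, maskLayer 3 (pad n D (1 : Matrix (Fin d) (Fin d) ℝ)), sumLayer n D,
    mulLayer n D 1 3, linLayer n D 3 2 γ 1,
    linLayer n D 1 3 0 1, maskLayer 3 (pad n D Gᵀ), sumLayer n D,
    mulLayer n D 2 3, convLayer 3 (allOnes n D),
    maskLayer 3 (pad n D Vᵀ), sumLayer n D,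
    maskLayer 3 (pad n D (1 : Matrix (Fin d) (Fin d) ℝ)), convLayer 3 (allOnes n D),
    maskLayer 3 (impulse n D 0), linLayer n D 3 1 0 1,
    maskLayer 0 (allOnes n D - impulse n D 0), linLayer n D 1 0 1 1,
    convLayer 0 (impulse n D (n - 1))]

theorem update_zero {α : Type*} (a b c e x : α) :
    Function.update ![a, b, c, e] 0 x = ![x, b, c, e] := by
  funext i; fin_cases i <;> rfl

theorem update_one {α : Type*} (a b c e x : α) :
    Function.update ![a, b, c, e] 1 x = ![a, x, c, e] := by
  funext i; fin_cases i <;> rfl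

theorem update_two {α : Type*} (a b c e x : α) :
    Function.update ![a, b, c, e] 2 x = ![a, b, x, e] := by
  funext i; fin_cases i <;> rfl

theorem update_three {α : Type*} (a b c e x : α) :
    Function.update ![a, b, c, e] 3 x = ![a, b, c, x] := by
  funext i; fin_cases i <;> rfl

theorem get_zero {α : Type*} (a b c e : α) : ![a, b, c, e] 0 = a := rfl
theorem get_one {α : Type*} (a b c e : α) : ![a, b, c, e] 1 = b := rfl
theorem get_two {α : Type*} (a b c e : α) : ![a, b, c, e] 2 = c := rfl
theorem get_three {α : Type*} (a b c e : α) : ![a, b, c, e] 3 = e := rfl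

/-- Row 0 is broadcast as `x` along rows, and a copy is converted by the identity mask to a column
broadcast; their entrywise product is `xᵀ x`, which updates the state. The masks `Gᵀ`, the state and
`Vᵀ` then give, in turn, column, row and column broadcasts of the partial products. A last identity
mask yields a row broadcast, whose row 0 replaces that of the tape before the rotation. The result
travels from register 3 to 0 through 1, since 3 and 0 differ in both bits. The temporaries `w'` and
`v'` are arbitrary because the next step overwrites them. -/
theorem stepLayers_eval (hn : 0 < n) (hdn : d ≤ n) (hdD : d ≤ D) (γ : ℝ)
    (G V : Matrix (Fin d) (Fin d) ℝ) (T w v : Matrix (Fin n) (Fin D) ℝ)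
    (Z : Matrix (Fin d) (Fin d) ℝ) {x : Fin d → ℝ}
    (hx : ∀ j : Fin D, T ⟨0, hn⟩ j = padVec x j) :
    ∃ w' v' : Matrix (Fin n) (Fin D) ℝ,
      (stepLayers n D γ G V).foldl (fun y ℓ => ℓ.eval y) (pack ![T, w, pad n D Z, v]) =
        pack ![cyclicConv (T ⊙ (allOnes n D - impulse n D 0) +
            rowCast n D ((x ᵥ* G) ᵥ* (γ • Z + vecMulVec x x) ᵥ* V) ⊙ impulse n D 0)
              (impulse n D (n - 1)), w',
          pad n D (γ • Z + vecMulVec x x), v'] := by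
  simp only [stepLayers, List.foldl_cons, List.foldl_nil, linLayer_eval, mulLayer_eval,
    maskLayer_eval, convLayer_eval, sumLayer_eval, update_zero, update_one, update_two,
    update_three, get_zero, get_one, get_two, get_three, ne_eq, Fin.reduceEq, not_false_eq_true,
    zero_smul, one_smul, zero_add, cyclicConv_hadamard_impulse hn T hx,
    rowCast_hadamard_pad_mul hdD, Matrix.one_mulVec, Matrix.vecMul_one, rowCast_hadamard_colCast,
    pad_smul_add, Matrix.mulVec_transpose, hadamard_comm (pad n D _) (colCast n D _),
    cyclicConv_colCast_hadamard_pad hdn]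
  exact ⟨_, _, rfl⟩

/-- The tape `τ`, read from position `c` on. -/
def tapeMatrix (n D : ℕ) (τ : ℕ → Fin d → ℝ) (c : ℕ) : Matrix (Fin n) (Fin D) ℝ :=
  Matrix.of fun i j => padVec (τ (((i : ℕ) + c) % n)) j

theorem cyclicConv_tapeMatrix (τ : ℕ → Fin d → ℝ) (c : ℕ) {s : ℕ} (hs : s < n) :
    cyclicConv (tapeMatrix n D τ c) (impulse n D s) = tapeMatrix n D τ (c + (n - s)) := by
  ext i j
  rw [cyclicConv_impulse _ hs]
  simp only [tapeMatrix, Matrix.of_apply, Nat.mod_add_mod]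
  congr 3
  ring

theorem tapeMatrix_write (τ : ℕ → Fin d → ℝ) {c : ℕ} (hc : c < n) (x : Fin d → ℝ) :
    tapeMatrix n D τ c ⊙ (allOnes n D - impulse n D 0) + rowCast n D x ⊙ impulse n D 0 =
      tapeMatrix n D (Function.update τ c x) c := by
  ext i j
  by_cases hi : (i : ℕ) = 0
  · simp [tapeMatrix, rowCast, allOnes, impulse, hi, Nat.mod_eq_of_lt hc]
  · have hne : ((i : ℕ) + c) % n ≠ c := by
      rw [ne_eq, add_mod_eq_iff i.2 hc hc.le, Nat.add_sub_cancel' hc.le, Nat.mod_self]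
      exact hi
    simp [tapeMatrix, rowCast, allOnes, impulse, hi, hne]

/-- The recurrence `Zₙ₊₁ = γ Zₙ + xₙᵀ xₙ`. -/
def gramState (γ : ℝ) (x : ℕ → Fin d → ℝ) : ℕ → Matrix (Fin d) (Fin d) ℝ
  | 0 => 0
  | k + 1 => γ • gramState γ x k + vecMulVec (x k) (x k)

theorem gramState_succ (γ : ℝ) (x : ℕ → Fin d → ℝ) (k : ℕ) :
    gramState γ x (k + 1) = γ • gramState γ x k + vecMulVec (x k) (x k) := rfl

/-- The tape after `k` steps: outputs up to position `k`, inputs from there on. -/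
def tapeAfter (γ : ℝ) (G V : Matrix (Fin d) (Fin d) ℝ) (x : ℕ → Fin d → ℝ) (k p : ℕ) :
    Fin d → ℝ :=
  if p < k then (x p ᵥ* G) ᵥ* gramState γ x (p + 1) ᵥ* V else x p

theorem tapeAfter_succ (γ : ℝ) (G V : Matrix (Fin d) (Fin d) ℝ) (x : ℕ → Fin d → ℝ) (k : ℕ) :
    Function.update (tapeAfter γ G V x k) k ((x k ᵥ* G) ᵥ* gramState γ x (k + 1) ᵥ* V) =
      tapeAfter γ G V x (k + 1) := by
  funext p
  by_cases h : p = k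
  · subst h
    simp [tapeAfter]
  · have : p < k + 1 ↔ p < k := by omega
    simp [tapeAfter, h, this]

/-- Loop invariant: after `k` steps the head is at position `k`, earlier positions hold outputs,
later ones still hold inputs, and the third register holds the Gram state. Writing an output
destroys no input that is needed later. -/
theorem flatten_replicate_eval (hdn : d ≤ n) (hdD : d ≤ D) (γ : ℝ)
    (G V : Matrix (Fin d) (Fin d) ℝ) (x : ℕ → Fin d → ℝ) {k : ℕ} (hk : k ≤ n) :
    ∃ w v : Matrix (Fin n) (Fin D) ℝ,
      (List.replicate k (stepLayers n D γ G V)).flatten.foldl (fun y ℓ => ℓ.eval y)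
          (pack ![tapeMatrix n D x 0, 0, 0, 0]) =
        pack ![tapeMatrix n D (tapeAfter γ G V x k) k, w, pad n D (gramState γ x k), v] := by
  induction k with
  | zero =>
    refine ⟨0, 0, ?_⟩
    have h0 : pad n D (gramState γ x 0) = 0 := by ext i j; simp [pad, gramState]
    have h1 : tapeAfter γ G V x 0 = x := by funext p; simp [tapeAfter]
    simp [h0, h1]
  | succ k ih =>
    obtain ⟨w, v, h⟩ := ih (by omega)
    have hn : 0 < n := by omega
    have hx : ∀ j : Fin D, tapeMatrix n D (tapeAfter γ G V x k) k ⟨0, hn⟩ j = padVec (x k) j := by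
      intro j
      simp [tapeMatrix, Nat.mod_eq_of_lt (show k < n by omega), tapeAfter]
    obtain ⟨w', v', h'⟩ := stepLayers_eval hn hdn hdD γ G V _ w v (gramState γ x k) hx
    refine ⟨w', v', ?_⟩
    rw [List.replicate_succ', List.flatten_append, List.foldl_append, h, List.flatten_singleton,
      h', tapeMatrix_write _ (by omega), cyclicConv_tapeMatrix _ _ (by omega)]
    -- A cyclic shift by `n - 1` moves the rows up by one, so the head advances to the next
    -- position.
    have h1 : n - (n - 1) = 1 := by omega
    rw [h1]
    have h2 := tapeAfter_succ γ G V x k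
    rw [gramState] at h2
    rw [h2, gramState]

/-- Each transfer between registers runs along the cycle 0, 1, 3, 2, in which neighbours differ in
one bit; `decide` checks this. -/
theorem isKMatrix_stepLayers {k : ℕ} (γ : ℝ) (G V : Matrix (Fin d) (Fin d) ℝ) :
    ∀ ℓ ∈ stepLayers n (2 ^ k) γ G V, IsKMatrix 1 (4 * 2 ^ k) ℓ.W := by
  simp only [stepLayers, List.forall_mem_cons]
  refine ⟨?_, ?_, ?_, ?_, ?_, ?_, ?_, ?_, ?_, ?_, ?_, ?_, ?_, ?_, ?_, ?_, ?_, ?_, ?_, ?_, ?_, ?_,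
    by simp⟩
  all_goals first
    | exact isKMatrix_maskLayer _ _
    | exact isKMatrix_convLayer _ _
    | exact isKMatrix_sumLayer _
    | exact isKMatrix_linLayer _ _ (by decide)
    | exact isKMatrix_mulLayer (by decide)

end Step

/-! ### The simulation of a RetNet -/

section Simulation

variable {N d : ℕ} (R : RetNet d)

/-- The rows of a matrix, extended by zero rows. -/
def rowSeq (u : Matrix (Fin N) (Fin d) ℝ) (p : ℕ) : Fin d → ℝ :=
  if h : p < N then u ⟨p, h⟩ else 0

/-- The map `Z ↦ W_Aᵀ Z W_V` is linear and carries `xᵀ x` to the RetNet's rank-one term, so it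
intertwines the two recurrences. The index is `p + 1` because `gramState` starts from zero before
the first row. -/
theorem RetNet.state_eq (u : Matrix (Fin N) (Fin d) ℝ) (p : ℕ) (hp : p < N) :
    R.state u p hp = R.WAᵀ * gramState R.γ (rowSeq u) (p + 1) * R.WV := by
  have hvec : ∀ x : Fin d → ℝ,
      vecMulVec (x ᵥ* R.WA) (x ᵥ* R.WV) = R.WAᵀ * vecMulVec x x * R.WV := by
    intro x
    rw [Matrix.mul_vecMulVec, Matrix.vecMulVec_mul, Matrix.mulVec_transpose]
  have hrow : ∀ (W : Matrix (Fin d) (Fin d) ℝ) (q : ℕ) (hq : q < N),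
      (u * W) ⟨q, hq⟩ = rowSeq u q ᵥ* W := by
    intro W q hq
    simp only [rowSeq, hq, dif_pos]
    rfl
  induction p with
  | zero => simp [RetNet.state, gramState, hrow, hvec]
  | succ p ih =>
    rw [RetNet.state, ih, gramState_succ _ _ (p + 1), hrow, hrow, hvec, Matrix.mul_add,
      Matrix.add_mul]
    simp

theorem RetNet.output_eq (u : Matrix (Fin N) (Fin d) ℝ) (p : Fin N) :
    R.output u p =
      (u p ᵥ* (R.WC * R.WAᵀ)) ᵥ* gramState R.γ (rowSeq u) (p + 1) ᵥ* R.WV := by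
  have h : R.output u p = (u p ᵥ* R.WC) ᵥ* R.state u p p.isLt := rfl
  simp only [h, RetNet.state_eq, Matrix.vecMul_vecMul, Matrix.mul_assoc]

/-- The layers of the BaseConv model that simulates a RetNet, with registers of width `D`. -/
def RetNet.modelLayers (N D : ℕ) : List (BaseConvLayer (N + D) (4 * D)) :=
  (List.replicate N (stepLayers (N + D) D R.γ (R.WC * R.WAᵀ) R.WV)).flatten ++
    [convLayer 0 (impulse (N + D) D N)]

/-- Weight sharing: the distinct layers all lie in a list whose length does not depend on `N`. -/
theorem RetNet.mem_of_mem_modelLayers {D : ℕ} {ℓ : BaseConvLayer (N + D) (4 * D)}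
    (h : ℓ ∈ R.modelLayers N D) :
    ℓ ∈ stepLayers (N + D) D R.γ (R.WC * R.WAᵀ) R.WV ++ [convLayer 0 (impulse (N + D) D N)] := by
  simp only [RetNet.modelLayers, List.mem_append, List.mem_flatten, List.mem_replicate] at h ⊢
  rcases h with ⟨l, ⟨-, rfl⟩, h⟩ | h
  · exact Or.inl h
  · exact Or.inr h

theorem RetNet.isKMatrix_modelLayers {k : ℕ} :
    ∀ ℓ ∈ R.modelLayers N (2 ^ k), IsKMatrix 1 (4 * 2 ^ k) ℓ.W := by
  intro ℓ hℓ
  rcases List.mem_append.1 (R.mem_of_mem_modelLayers hℓ) with h | h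
  · exact isKMatrix_stepLayers _ _ _ ℓ h
  · rw [List.mem_singleton.1 h]
    exact isKMatrix_convLayer _ _

/-- The BaseConv model that simulates a RetNet, with registers of width `D`. -/
def RetNet.model (N : ℕ) {D : ℕ} (hD : d ≤ D) : BaseConvModel N d where
  N' := N + D
  d' := 4 * D
  hN := Nat.le_add_right N D
  hd := by omega
  layers := R.modelLayers N D

theorem pack_apply {n D : ℕ} (Y : Fin 4 → Matrix (Fin n) (Fin D) ℝ) (r : Fin n)
    (c : Fin (4 * D)) : pack Y r c = Y c.divNat r c.modNat := rfl

theorem pad_apply {a b n m : ℕ} (M : Matrix (Fin a) (Fin b) ℝ) (i : Fin n) (j : Fin m) :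
    pad n m M i j = if h : (i : ℕ) < a ∧ (j : ℕ) < b then M ⟨i, h.1⟩ ⟨j, h.2⟩ else 0 := rfl

theorem tapeMatrix_apply {n D : ℕ} (τ : ℕ → Fin d → ℝ) (c : ℕ) (i : Fin n) (j : Fin D) :
    tapeMatrix n D τ c i j = padVec (τ (((i : ℕ) + c) % n)) j := rfl

theorem pad_eq_pack {D : ℕ} (hD : d ≤ D) (u : Matrix (Fin N) (Fin d) ℝ) :
    pad (N + D) (4 * D) u = pack ![tapeMatrix (N + D) D (rowSeq u) 0, 0, 0, 0] := by
  ext i c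
  obtain ⟨⟨a, j⟩, rfl⟩ := (finProdFinEquiv (m := 4) (n := D)).surjective c
  have h := finProdFinEquiv.symm_apply_apply (a, j)
  rw [finProdFinEquiv_symm_apply, Prod.mk.injEq] at h
  have hval : (finProdFinEquiv (a, j) : ℕ) = j + D * a := rfl
  rw [pack_apply, h.1, h.2, pad_apply]
  by_cases ha : a = 0
  · subst ha
    simp only [hval, Fin.val_zero, mul_zero, add_zero, get_zero, tapeMatrix_apply,
      Nat.mod_eq_of_lt i.2, padVec, rowSeq]
    split_ifs <;> first | (exfalso; tauto) | rfl
  · have h0 : (![tapeMatrix (N + D) D (rowSeq u) 0, 0, 0, 0] :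
        Fin 4 → Matrix (Fin (N + D)) (Fin D) ℝ) a = 0 := by
      fin_cases a <;> first | exact absurd rfl ha | rfl
    have ha' : 1 ≤ (a : ℕ) := Nat.one_le_iff_ne_zero.2 fun h => ha (Fin.ext h)
    have : D * 1 ≤ D * a := Nat.mul_le_mul_left D ha'
    rw [h0, dif_neg (by rw [hval]; omega)]
    rfl

theorem RetNet.foldl_modelLayers {D : ℕ} (hD : d ≤ D) (hDpos : 0 < D)
    (u : Matrix (Fin N) (Fin d) ℝ) :
    ∃ w v : Matrix (Fin (N + D)) (Fin D) ℝ,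
      (R.modelLayers N D).foldl (fun y ℓ => ℓ.eval y) (pad (N + D) (4 * D) u) =
        pack ![tapeMatrix (N + D) D (tapeAfter R.γ (R.WC * R.WAᵀ) R.WV (rowSeq u) N) (N + D),
          w, pad (N + D) D (gramState R.γ (rowSeq u) N), v] := by
  obtain ⟨w, v, h⟩ := flatten_replicate_eval (n := N + D) (D := D) (by omega) hD R.γ
    (R.WC * R.WAᵀ) R.WV (rowSeq u) (k := N) (by omega)
  refine ⟨w, v, ?_⟩
  -- After `N` steps the head is at `N`; the last shift completes a full turn of the tape of length
  -- `N + D`.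
  have hN : N + (N + D - N) = N + D := by omega
  rw [pad_eq_pack hD, RetNet.modelLayers, List.foldl_append, h, List.foldl_cons, List.foldl_nil,
    convLayer_eval, update_zero, get_zero, cyclicConv_tapeMatrix _ _ (by omega), hN]

theorem RetNet.model_eval {D : ℕ} (hD : d ≤ D) (u : Matrix (Fin N) (Fin d) ℝ) :
    (R.model N hD).eval u = R.output u := by
  ext p t
  obtain ⟨w, v, h⟩ := R.foldl_modelLayers hD (lt_of_lt_of_le t.pos hD) u
  have hd : d ≤ 4 * D := by omega
  have htD : (t : ℕ) < D := t.2.trans_le hD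
  have hdiv : (Fin.castLE hd t).divNat = (0 : Fin 4) := Fin.ext (Nat.div_eq_of_lt htD)
  have hmod : ((Fin.castLE hd t).modNat : ℕ) = t := Nat.mod_eq_of_lt htD
  have hp : (p : ℕ) < N + D := by omega
  change (R.modelLayers N D).foldl (fun y ℓ => ℓ.eval y) (pad (N + D) (4 * D) u)
    (Fin.castLE (Nat.le_add_right N D) p) (Fin.castLE hd t) = _
  rw [h, RetNet.output_eq, pack_apply, hdiv, get_zero, tapeMatrix_apply, Fin.val_castLE,
    Nat.add_mod_right, Nat.mod_eq_of_lt hp, hmod]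
  simp [padVec, tapeAfter, rowSeq]

theorem RetNet.model_numLayers {D : ℕ} (hD : d ≤ D) :
    (R.model N hD).numLayers = 22 * N + 1 := by
  simp [BaseConvModel.numLayers, RetNet.model, RetNet.modelLayers, stepLayers]
  ring

theorem RetNet.model_numParams_le {D : ℕ} (hD : d ≤ D) :
    (R.model N hD).numParams ≤ 23 * (3 * ((N + D) * (4 * D)) + (4 * D) ^ 2) := by
  classical
  refine Nat.mul_le_mul_right _ ?_
  let L := stepLayers (N + D) D R.γ (R.WC * R.WAᵀ) R.WV ++ [convLayer 0 (impulse (N + D) D N)]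
  have hsub : {ℓ | ℓ ∈ R.modelLayers N D} ⊆ (L.toFinset : Set (BaseConvLayer _ _)) := by
    intro ℓ hℓ
    rw [List.coe_toFinset]
    exact R.mem_of_mem_modelLayers hℓ
  calc {ℓ | ℓ ∈ R.modelLayers N D}.ncard ≤ (L.toFinset : Set (BaseConvLayer _ _)).ncard :=
        Set.ncard_le_ncard hsub (Finset.finite_toSet _)
    _ = L.toFinset.card := Set.ncard_coe_finset _
    _ ≤ L.length := List.toFinset_card_le L
    _ = 23 := by simp [L, stepLayers]

end Simulation

end BaseConvSim

end

/-! ### Choice of the width and of the constants -/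

theorem mainTheorem6 :
    ∃ (κ : ℕ) (C : ℝ), ∀ (N d : ℕ), 2 ≤ d → ∀ R : BaseConvSim.RetNet d,
      ∃ M : BaseConvSim.BaseConvModel N d,
        (∀ ℓ ∈ M.layers, BaseConvSim.IsKMatrix κ M.d' ℓ.W) ∧
        (∀ u : Matrix (Fin N) (Fin d) ℝ, M.eval u = R.output u) ∧
        (M.numLayers : ℝ) ≤ C * ((N : ℝ) * Real.log (d : ℝ)) ∧
        (M.numParams : ℝ) ≤ C * ((N : ℝ) * (d : ℝ) + (d : ℝ) ^ 2) ∧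
        (d ≤ N → (M.numParams : ℝ) ≤ C * ((N : ℝ) * (d : ℝ))) := by
  refine ⟨1, 10000, fun N d hd R => ?_⟩
  -- For `N = 0` the layer bound is 0, which the final rotation alone would violate; the empty model
  -- is used instead.
  rcases Nat.eq_zero_or_pos N with rfl | hN
  · refine ⟨⟨0, d, le_rfl, le_rfl, []⟩, by simp, fun u => ?_, ?_, ?_, by omega⟩
    · ext i
      exact i.elim0
    · simp [BaseConvSim.BaseConvModel.numLayers]
    · simp [BaseConvSim.BaseConvModel.numParams]
  -- The register width is the least power of two that is at least `d`: butterfly matrices need a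
  -- power of two, and the width stays below `2 * d`, up to equality.
  have hD1 : d ≤ 2 ^ Nat.clog 2 d := Nat.le_pow_clog one_lt_two d
  have hD2 : 2 ^ Nat.clog 2 d ≤ 2 * d := by
    have h1 : 2 ^ (Nat.clog 2 d).pred < d := Nat.pow_pred_clog_lt_self one_lt_two (by omega)
    have h2 : 0 < Nat.clog 2 d := Nat.clog_pos one_lt_two hd
    rw [← Nat.succ_pred_eq_of_pos h2, pow_succ]
    omega
  have hd' : (2 : ℝ) ≤ d := by exact_mod_cast hd
  have hN' : (1 : ℝ) ≤ N := by exact_mod_cast hN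
  have hparams : ((R.model N hD1).numParams : ℝ) ≤ 5000 * ((N : ℝ) * d + (d : ℝ) ^ 2) := by
    have h1 : (R.model N hD1).numParams ≤
        23 * (3 * ((N + 2 * d) * (4 * (2 * d))) + (4 * (2 * d)) ^ 2) :=
      (R.model_numParams_le hD1).trans (by gcongr)
    have h2 : ((R.model N hD1).numParams : ℝ) ≤
        23 * (3 * ((N + 2 * d) * (4 * (2 * d))) + (4 * (2 * d)) ^ 2) := by exact_mod_cast h1
    refine h2.trans ?_
    have h3 : 0 ≤ (N : ℝ) * d := by positivity
    have h4 : 0 ≤ (d : ℝ) ^ 2 := by positivity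
    linarith [show (23 * (3 * ((N + 2 * d) * (4 * (2 * d))) + (4 * (2 * d)) ^ 2) : ℝ) =
      552 * ((N : ℝ) * d) + 2576 * (d : ℝ) ^ 2 by ring]
  refine ⟨R.model N hD1, R.isKMatrix_modelLayers, R.model_eval hD1, ?_, ?_, fun hdN => ?_⟩
  · rw [R.model_numLayers]
    push_cast
    -- As `d ≥ 2`, the logarithm is bounded below, so the `22 * N + 1` layers are absorbed into a
    -- multiple of `N * log d`.
    have h1 : (1 / 2 : ℝ) ≤ Real.log d :=
      (by linarith [Real.log_two_gt_d9] : (1 / 2 : ℝ) ≤ Real.log 2).trans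
        (Real.log_le_log two_pos hd')
    have h2 : (N : ℝ) * (1 / 2) ≤ N * Real.log d := mul_le_mul_of_nonneg_left h1 (by positivity)
    linarith
  · have : 0 ≤ (N : ℝ) * d + (d : ℝ) ^ 2 := by positivity
    linarith
  · have h1 : (d : ℝ) ≤ N := by exact_mod_cast hdN
    -- Absorbing `d ^ 2` into `N * d` doubles the constant 5000, hence the choice of 10000.
    have h2 : (d : ℝ) ^ 2 ≤ N * d := by
      rw [sq]
      exact mul_le_mul_of_nonneg_right h1 (by positivity)
    linarith
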